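/- Conventions. Models of ZFC are arbitrary structures $\langle M,\in^M\rangle$ in the language $\{\in\}$ satisfying ZFC. A model of ZFC is *$\omega$-nonstandard* if its $\omega$ has an element that is not a standard natural number. A model $M$ *is an element of* a model $N$ if there is an object of $N$ that $N$ thinks is a pair $\langle m,E\rangle$ with $E$ a binary relation on $m$, such that the set $\{a\in N : N\models a\in m\}$ with the relation $\{(a,b) : N\models a\,E\,b\}$ is isomorphic to $\langle M,\in^M\rangle$ ($N$ itself need not regard this structure as a model of ZFC). A model $M$ is *computably saturated* if for every finite tuple $\bar a$ in $M$ and every set $p(\bar y,\bar x)$ of formulas in finitely many variables whose set of Gödel codes is computable, if every finite subset of $p(\bar a,\bar x)$ is realized in $M$, then $p(\bar a,\bar x)$ is realized in $M$. A *multiverse* is a nonempty collection $\mathcal M$ of models of ZFC; it satisfies the *Wellfoundedness Mirage* axiom if for every $M\in\mathcal M$ there is $N\in\mathcal M$ such that $M$ is an element of $N$ and $N$ thinks that $M$ is a set with an ill-founded $\omega$. Theorem. 1. Every model of ZFC that is an element of an $\omega$-nonstandard model of ZFC is computably saturated. 2. Every multiverse satisfying the Wellfoundedness Mirage axiom consists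 entirely of computably saturated models of ZFC. -/

import Mathlib

open FirstOrder

universe u v w

namespace SetModels

/-! ### The language of set theory and Gödel codes of its formulas -/

/-- The only non-logical symbol of set theory: a binary relation symbol. -/
inductive MemRel : ℕ → Type
  | mem : MemRel 2

/-- The first-order language `{∈}` of set theory. -/
def LSet : FirstOrder.Language.{0, 0} := ⟨fun _ => Empty, MemRel⟩

/-- The symbol `∈`. -/
abbrev memSymb : LSet.Relations 2 := MemRel.mem

/-- The atomic formula `t ∈ s`. -/
def memF {α : Type u} {n : ℕ} (t s : LSet.Term (α ⊕ Fin n)) : LSet.BoundedFormula α n :=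
  memSymb.boundedFormula₂ t s

/-- The code of a term. The language has no function symbols, so a term is a variable. -/
def termCode {β : Type u} [Encodable β] : LSet.Term β → ℕ
  | .var b => Encodable.encode b
  | .func f _ => nomatch f

/-- The Gödel code of a formula whose free variables are indexed by `α`. -/
def godelCode {α : Type u} [Encodable α] : {n : ℕ} → LSet.BoundedFormula α n → ℕ
  | _, .falsum => 0
  | _, .equal t s => 4 * Nat.pair (termCode t) (termCode s) + 1
  | _, .rel .mem ts => 4 * Nat.pair (termCode (ts 0)) (termCode (ts 1)) + 2
  | _, .imp φ ψ => 4 * Nat.pair (godelCode φ) (godelCode ψ) + 3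
  | _, .all φ => 4 * godelCode φ + 4

theorem termCode_injective {β : Type u} [Encodable β] :
    Function.Injective (termCode : LSet.Term β → ℕ)
  | .var _, .var _, h => congrArg _ (Encodable.encode_injective h)
  | .func f _, _, _ => nomatch f
  | _, .func f _, _ => nomatch f

theorem godelCode_injective {α : Type u} [Encodable α] {n : ℕ} :
    Function.Injective (godelCode : LSet.BoundedFormula α n → ℕ) := by
  intro φ
  induction φ with
  | falsum =>
    rintro (_ | _ | ⟨⟨⟩, _⟩ | _ | _) h <;> simp only [godelCode] at h <;> first | rfl | omega
  | equal t s =>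
    rintro (_ | ⟨t', s'⟩ | ⟨⟨⟩, _⟩ | _ | _) h <;> simp only [godelCode] at h <;> try omega
    obtain ⟨h1, h2⟩ := Nat.pair_eq_pair.1 (by omega :
      Nat.pair (termCode t) (termCode s) = Nat.pair (termCode t') (termCode s'))
    rw [termCode_injective h1, termCode_injective h2]
  | rel R ts =>
    cases R
    intro ψ h
    cases ψ with
    | rel R' ts' =>
      cases R'
      simp only [godelCode] at h
      obtain ⟨h1, h2⟩ := Nat.pair_eq_pair.1 (by omega :
        Nat.pair (termCode (ts 0)) (termCode (ts 1)) =
          Nat.pair (termCode (ts' 0)) (termCode (ts' 1)))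
      congr 1
      funext i
      fin_cases i
      · exact termCode_injective h1
      · exact termCode_injective h2
    | _ => simp only [godelCode] at h; omega
  | imp φ₁ φ₂ ih₁ ih₂ =>
    rintro (_ | _ | ⟨⟨⟩, _⟩ | ⟨ψ₁, ψ₂⟩ | _) h <;> simp only [godelCode] at h <;> try omega
    obtain ⟨h1, h2⟩ := Nat.pair_eq_pair.1 (by omega :
      Nat.pair (godelCode φ₁) (godelCode φ₂) = Nat.pair (godelCode ψ₁) (godelCode ψ₂))
    rw [ih₁ h1, ih₂ h2]
  | all φ ih =>
    rintro (_ | _ | ⟨⟨⟩, _⟩ | _ | ψ) h <;> simp only [godelCode] at h <;> try omega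
    rw [ih (by omega : godelCode φ = godelCode ψ)]

/-! ### The axioms of ZFC -/

section Axioms

open FirstOrder.Language

/-- `∀ x y, (∀ z, z ∈ x ↔ z ∈ y) → x = y`. -/
def extensionality : LSet.Sentence :=
  ∀' ∀' ((∀' ((memF (&2) (&0)).iff (memF (&2) (&1)))).imp ((&0).bdEqual (&1)))

/-- `∀ x, (∃ y, y ∈ x) → ∃ y, y ∈ x ∧ ∀ z, z ∈ y → z ∉ x`. -/
def foundation : LSet.Sentence :=
  ∀' ((∃' (memF (&1) (&0))).imp
    (∃' (memF (&1) (&0) ⊓ ∀' ((memF (&2) (&1)).imp (memF (&2) (&0)).not))))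

/-- `∀ x y, ∃ p, ∀ z, z ∈ p ↔ z = x ∨ z = y`. -/
def pairing : LSet.Sentence :=
  ∀' ∀' ∃' ∀' ((memF (&3) (&2)).iff ((&3).bdEqual (&0) ⊔ (&3).bdEqual (&1)))

/-- `∀ x, ∃ u, ∀ z, z ∈ u ↔ ∃ y, y ∈ x ∧ z ∈ y`. -/
def union : LSet.Sentence :=
  ∀' ∃' ∀' ((memF (&2) (&1)).iff (∃' (memF (&3) (&0) ⊓ memF (&2) (&3))))

/-- `∀ x, ∃ p, ∀ z, z ∈ p ↔ ∀ y, y ∈ z → y ∈ x`. -/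
def powerset : LSet.Sentence :=
  ∀' ∃' ∀' ((memF (&2) (&1)).iff (∀' ((memF (&3) (&2)).imp (memF (&3) (&0)))))

/-- `∃ x, (∃ y, y ∈ x ∧ ∀ z, z ∉ y) ∧ ∀ y, y ∈ x → ∃ s, s ∈ x ∧ ∀ z, z ∈ s ↔ z ∈ y ∨ z = y`. -/
def infinity : LSet.Sentence :=
  ∃' ((∃' (memF (&1) (&0) ⊓ ∀' (memF (&2) (&1)).not)) ⊓
    ∀' ((memF (&1) (&0)).imp (∃' (memF (&2) (&0) ⊓
      ∀' ((memF (&3) (&2)).iff (memF (&3) (&1) ⊔ (&3).bdEqual (&1)))))))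

/-- Every set of nonempty, pairwise disjoint sets has a transversal:
`∀ a, (∀ x, x ∈ a → ∃ y, y ∈ x) ∧ (∀ x y, x ∈ a ∧ y ∈ a ∧ (∃ z, z ∈ x ∧ z ∈ y) → x = y) →
  ∃ c, ∀ x, x ∈ a → ∃ y, ∀ z, z ∈ x ∧ z ∈ c ↔ z = y`. -/
def choice : LSet.Sentence :=
  ∀' (((∀' ((memF (&1) (&0)).imp (∃' (memF (&2) (&1))))) ⊓
      (∀' ∀' ((memF (&1) (&0) ⊓ memF (&2) (&0) ⊓ ∃' (memF (&3) (&1) ⊓ memF (&3) (&2))).imp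
        ((&1).bdEqual (&2))))).imp
    (∃' ∀' ((memF (&2) (&0)).imp
      (∃' ∀' ((memF (&4) (&2) ⊓ memF (&4) (&1)).iff ((&4).bdEqual (&3)))))))

/-- The formula `φ` with its `i`-th free variable replaced by the bound variable of index `g i`. -/
def place {k n : ℕ} (φ : LSet.Formula (Fin k)) (g : Fin k → Fin n) : LSet.BoundedFormula Empty n :=
  BoundedFormula.relabel (fun i => Sum.inr (g i)) φ

/-- The instance of Separation for `φ(p, x)`, with parameters `p = (p₀, …, pₙ₋₁)`:
`∀ p, ∀ a, ∃ b, ∀ x, x ∈ b ↔ x ∈ a ∧ φ(p, x)`. Here `a`, `b`, `x` have index `n`, `n+1`, `n+2`. -/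
def separation {n : ℕ} (φ : LSet.Formula (Fin (n + 1))) : LSet.Sentence :=
  BoundedFormula.alls (n := n) <| ∀' ∃' ∀'
    ((memF (&⟨n + 2, by omega⟩) (&⟨n + 1, by omega⟩)).iff
      (memF (&⟨n + 2, by omega⟩) (&⟨n, by omega⟩) ⊓
        place (n := n + 3) φ
          (Fin.snoc (fun i => ⟨i, by omega⟩) ⟨n + 2, by omega⟩)))

/-- The instance of Replacement for `φ(p, x, y)`, with parameters `p = (p₀, …, pₙ₋₁)`:
`∀ p, ∀ a, (∀ x, x ∈ a → ∀ y z, φ(p, x, y) ∧ φ(p, x, z) → y = z) →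
  ∃ b, ∀ y, y ∈ b ↔ ∃ x, x ∈ a ∧ φ(p, x, y)`.
Here `a` has index `n`; in the premise `x`, `y`, `z` have index `n+1`, `n+2`, `n+3`; in the
conclusion `b`, `y`, `x` have index `n+1`, `n+2`, `n+3`. -/
def replacement {n : ℕ} (φ : LSet.Formula (Fin (n + 2))) : LSet.Sentence :=
  BoundedFormula.alls (n := n) <| ∀' (
    (∀' ((memF (&⟨n + 1, by omega⟩) (&⟨n, by omega⟩)).imp (∀' ∀'
      ((place (n := n + 4) φ (Fin.snoc (Fin.snoc (fun i => ⟨i, by omega⟩)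
            ⟨n + 1, by omega⟩) ⟨n + 2, by omega⟩) ⊓
        place (n := n + 4) φ (Fin.snoc (Fin.snoc (fun i => ⟨i, by omega⟩)
            ⟨n + 1, by omega⟩) ⟨n + 3, by omega⟩)).imp
        ((&⟨n + 2, by omega⟩).bdEqual (&⟨n + 3, by omega⟩)))))).imp
    (∃' ∀' ((memF (&⟨n + 2, by omega⟩) (&⟨n + 1, by omega⟩)).iff
      (∃' (memF (&⟨n + 3, by omega⟩) (&⟨n, by omega⟩) ⊓
        place (n := n + 4) φ (Fin.snoc (Fin.snoc (fun i => ⟨i, by omega⟩)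
            ⟨n + 3, by omega⟩) ⟨n + 2, by omega⟩))))))

/-- Zermelo–Fraenkel set theory with the axiom of choice. -/
def ZFC : LSet.Theory :=
  {extensionality, foundation, pairing, union, powerset, infinity, choice} ∪
    {σ | ∃ (n : ℕ) (φ : LSet.Formula (Fin (n + 1))), σ = separation φ} ∪
    {σ | ∃ (n : ℕ) (φ : LSet.Formula (Fin (n + 2))), σ = replacement φ}

end Axioms

/-! ### Computable saturation -/

/-- A set of formulas is computable if the set of Gödel codes of its members is. -/
def IsComputableType {α : Type u} [Encodable α] (p : Set (LSet.Formula α)) : Prop :=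
  ComputablePred fun c : ℕ => c ∈ godelCode '' p

/-- `M` is computably saturated: for every finite tuple `a` in `M` and every computable type
`p(y, x)` in finitely many variables, if `p(a, x)` is finitely realizable in `M`, then `p(a, x)`
is realized in `M`. -/
def ComputablySaturated (M : Type u) [LSet.Structure M] : Prop :=
  ∀ (k n : ℕ) (a : Fin k → M) (p : Set (LSet.Formula (Fin k ⊕ Fin n))),
    IsComputableType p →
    (∀ s : Finset (LSet.Formula (Fin k ⊕ Fin n)), (s : Set _) ⊆ p →
      ∃ x : Fin n → M, ∀ φ ∈ s, φ.Realize (Sum.elim a x)) →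
    ∃ x : Fin n → M, ∀ φ ∈ p, φ.Realize (Sum.elim a x)

/-! ### The natural numbers of a structure -/

/-- The membership relation of a structure for the language of set theory. -/
def Mem {M : Type u} [LSet.Structure M] (x y : M) : Prop :=
  FirstOrder.Language.Structure.RelMap memSymb ![x, y]

/-- `x = ∅`, in the sense of `E`. -/
def IsEmptySet {A : Type u} (E : A → A → Prop) (x : A) : Prop := ∀ z, ¬ E z x

/-- `y = x ∪ {x}`, in the sense of `E`. -/
def IsSuccOf {A : Type u} (E : A → A → Prop) (y x : A) : Prop := ∀ z, E z y ↔ E z x ∨ z = x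

/-- `x` contains `∅` and is closed under `y ↦ y ∪ {y}`, in the sense of `E`. -/
def IsInductive {A : Type u} (E : A → A → Prop) (x : A) : Prop :=
  (∃ z, IsEmptySet E z ∧ E z x) ∧ ∀ y, E y x → ∃ s, IsSuccOf E s y ∧ E s x

/-- `w = ω`, in the sense of `E`: `w` is the least inductive set. -/
def IsOmega {A : Type u} (E : A → A → Prop) (w : A) : Prop :=
  IsInductive E w ∧ ∀ x, IsInductive E x → ∀ z, E z w → E z x

/-- `x` is the numeral of the (standard) natural number `n`, in the sense of `E`. -/
def IsNumeral {A : Type u} (E : A → A → Prop) : ℕ → A → Prop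
  | 0, x => IsEmptySet E x
  | n + 1, x => ∃ y, IsNumeral E n y ∧ IsSuccOf E x y

/-- The `ω` of `M` has an element that is not a standard natural number. -/
def OmegaNonstandard (M : Type u) [LSet.Structure M] : Prop :=
  ∃ w : M, IsOmega Mem w ∧ ∃ x : M, Mem x w ∧ ∀ n : ℕ, ¬ IsNumeral Mem n x

/-! ### Structures inside a model of set theory -/

section Internal

variable {N : Type u} [LSet.Structure N]

/-- `q` is the Kuratowski pair `{{x}, {x, y}}` in `N`. -/
def IsPair (q x y : N) : Prop :=
  ∀ z, Mem z q ↔ (∀ t, Mem t z ↔ t = x) ∨ (∀ t, Mem t z ↔ t = x ∨ t = y)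

/-- In `N`, the object `e` is a binary relation on the set `m`. -/
def IsRelationOn (e m : N) : Prop :=
  ∀ q, Mem q e → ∃ x y, Mem x m ∧ Mem y m ∧ IsPair q x y

/-- The relation `{(a, b) | N ⊨ a e b}` on `{a | N ⊨ a ∈ m}`. -/
def extRel (m e : N) (a b : {a : N // Mem a m}) : Prop :=
  ∃ q, Mem q e ∧ IsPair q a.1 b.1

/-- The object `p` of `N` is, in `N`, a pair `⟨m, e⟩` with `e` a binary relation on `m`, and `M` is
isomorphic to `{a | N ⊨ a ∈ m}` with the relation `{(a, b) | N ⊨ a e b}`. -/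
def IsRepresentedBy (M : Type v) [LSet.Structure M] (p m e : N) : Prop :=
  IsPair p m e ∧ IsRelationOn e m ∧ Nonempty ((Mem : M → M → Prop) ≃r extRel m e)

/-- `N` thinks that the structure `⟨m, e⟩` has an ill-founded `ω`: there are `w`, which is the `ω` of
`⟨m, e⟩`, and a nonempty set `s` in `N` of `e`-elements of `w` that has no `e`-minimal element. -/
def ThinksOmegaIllFounded (m e : N) : Prop :=
  ∃ w : {a : N // Mem a m}, IsOmega (extRel m e) w ∧
    ∃ s : N, (∃ x, Mem x s) ∧
      (∀ x, Mem x s → ∃ hx : Mem x m, extRel m e ⟨x, hx⟩ w) ∧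
      ∀ x, Mem x s → ∃ y, Mem y s ∧ ∃ q, Mem q e ∧ IsPair q y x

end Internal

/-- `M` is (isomorphic to) an element of `N`. -/
def IsElementOf (M : Type v) [LSet.Structure M] (N : Type u) [LSet.Structure N] : Prop :=
  ∃ p m e : N, IsRepresentedBy M p m e

/-- A multiverse: a nonempty collection of models of ZFC. -/
structure Multiverse where
  models : Set (ZFC.ModelType : Type (u + 1))
  nonempty : models.Nonempty

/-- For every universe `M` in `𝓜` there is `N` in `𝓜` that thinks `M` is a set with an ill-founded
`ω`. -/
def Multiverse.WellfoundednessMirage (𝓜 : Multiverse.{u}) : Prop :=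
  ∀ M ∈ 𝓜.models, ∃ N ∈ 𝓜.models, ∃ p m e : N,
    IsRepresentedBy M p m e ∧ ThinksOmegaIllFounded m e

end SetModels

open SetModels

/-! Let `M` be the structure `⟨m, e⟩` of an `ω`-nonstandard `N`, and let `p(a, x)` be a computable,
finitely realizable type. Two things are definable in `N` with parameters: a relation that decides
membership in `p` for standard codes (`IsOmega.exists_dRel`), and a satisfaction relation for `⟨m,
e⟩` that is correct for standard codes (`sat_godelCode`). Let `P d` say that some assignment in `N`
extends `a` and satisfies every code below `d` that `N` puts into `p`. Finite realizability gives
`P` at every standard `d`. The standard cut is not definable in `N`, so `P` also holds at a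
nonstandard `d` (`IsOmega.overspill`). The assignment found there satisfies all standard members of
`p` at once, and its values at the variables `x` realize the type.

Nothing is claimed about what these definitions do at nonstandard arguments. Recursion inside `N`
therefore only has to be correct at numerals, where `iter_num_iff` reduces it to finite sequences
built by external induction.

For a multiverse, the mirage axiom is applied twice: `M` is an element of some `N`, and some `N'`
sees an ill-founded `ω` in `N`. The set without minimal element that witnesses this cannot consist
of standard numbers, so `N` is `ω`-nonstandard and the first part applies to `M`. -/

namespace SetModels

/-! ### Definability with parameters -/

section Definability

open FirstOrder.Language

/-- A context: a type whose elements can be read as finite tuples of elements of `N`. -/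
class Ctx (N : Type u) (γ : Type u) where
  /-- The number of variables. -/
  size : ℕ
  /-- The tuple of values of the variables. -/
  env : γ → Fin size → N

variable {N : Type u}

instance : Ctx N PUnit.{u + 1} := ⟨0, fun _ => Fin.elim0⟩

instance {γ : Type u} [Ctx N γ] : Ctx N (γ × N) :=
  ⟨Ctx.size N γ + 1, fun c => Fin.snoc (Ctx.env c.1) c.2⟩

variable {γ : Type u} [Ctx N γ]

variable (N) in
/-- `t` is a variable or a constant. -/
def IsAtom (t : γ → N) : Prop :=
  ∃ s : N ⊕ Fin (Ctx.size N γ), ∀ c, t c = Sum.elim id (Ctx.env c) s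

theorem IsAtom.const (a : N) : IsAtom N (fun _ : γ => a) := ⟨.inl a, fun _ => rfl⟩

theorem IsAtom.last : IsAtom N (fun p : γ × N => p.2) :=
  ⟨.inr (Fin.last _), fun c => (Fin.snoc_last (α := fun _ => N) c.2 (Ctx.env c.1)).symm⟩

theorem IsAtom.weaken {t : γ → N} (h : IsAtom N t) : IsAtom N (fun p : γ × N => t p.1) := by
  obtain ⟨s | i, h⟩ := h
  · exact ⟨.inl s, fun c => h c.1⟩
  · exact ⟨.inr i.castSucc, fun c => (h c.1).trans
      (Fin.snoc_castSucc (α := fun _ => N) c.2 (Ctx.env c.1) i).symm⟩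

theorem env_isAtom (i : Fin (Ctx.size N γ)) : IsAtom N (fun c : γ => Ctx.env c i) :=
  ⟨.inr i, fun _ => rfl⟩

/-- A map of contexts all of whose components are variables or constants. -/
def IsCtxMap {δ : Type u} [Ctx N δ] (f : γ → δ) : Prop :=
  ∀ i, IsAtom N (fun c => Ctx.env (f c) i)

theorem IsCtxMap.fst_fst : IsCtxMap (N := N) (fun c : (γ × N) × N => c.1.1) :=
  fun i => (env_isAtom i).weaken.weaken

theorem IsCtxMap.unit : IsCtxMap (N := N) (fun _ : γ => PUnit.unit.{u + 1}) := fun i => i.elim0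

theorem IsCtxMap.prod {δ : Type u} [Ctx N δ] {f : γ → δ} (hf : IsCtxMap (N := N) f) {t : γ → N}
    (ht : IsAtom N t) : IsCtxMap (N := N) (fun c => (f c, t c)) := by
  intro i
  refine Fin.lastCases ?_ (fun i => ?_) i
  · obtain ⟨s, hs⟩ := ht
    exact ⟨s, fun c => (Fin.snoc_last (α := fun _ => N) _ _).trans (hs c)⟩
  · obtain ⟨s, hs⟩ := hf i
    exact ⟨s, fun c => (Fin.snoc_castSucc (α := fun _ => N) _ _ i).trans (hs c)⟩

variable [LSet.Structure N]

variable (N) in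
/-- The predicate `P` on a context is definable in `N` with parameters. -/
class Dfn (P : γ → Prop) : Prop where
  out : ∃ φ : LSet.BoundedFormula N (Ctx.size N γ), ∀ c, φ.Realize id (Ctx.env c) ↔ P c

variable (N) in
/-- The function `t` from a context to `N` is definable in `N` with parameters. -/
class DFun (t : γ → N) : Prop where
  out : Dfn N (fun p : γ × N => p.2 = t p.1)

theorem Dfn.congr {P Q : γ → Prop} (h : Dfn N P) (hPQ : ∀ c, Q c ↔ P c) : Dfn N Q := by
  obtain ⟨φ, hφ⟩ := h
  exact ⟨φ, fun c => (hφ c).trans (hPQ c).symm⟩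

instance Dfn.all {P : γ → N → Prop} [h : Dfn N (fun p : γ × N => P p.1 p.2)] :
    Dfn N (fun c => ∀ x, P c x) := by
  obtain ⟨φ, hφ⟩ := h
  exact ⟨φ.all, fun c => by
    rw [BoundedFormula.realize_all]
    exact forall_congr' fun x => hφ (c, x)⟩

instance Dfn.imp {P Q : γ → Prop} [h : Dfn N P] [h' : Dfn N Q] : Dfn N (fun c => P c → Q c) := by
  obtain ⟨φ, hφ⟩ := h
  obtain ⟨ψ, hψ⟩ := h'
  exact ⟨φ.imp ψ, fun c => by rw [BoundedFormula.realize_imp, hφ, hψ]⟩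

instance (priority := low) Dfn.const (p : Prop) : Dfn N (fun _ : γ => p) := by
  by_cases h : p
  · exact ⟨⊤, fun c => by simp [h]⟩
  · exact ⟨⊥, fun c => by simp [h]⟩

instance Dfn.not {P : γ → Prop} [h : Dfn N P] : Dfn N (fun c => ¬ P c) :=
  (inferInstance : Dfn N (fun c => P c → False))

instance Dfn.and {P Q : γ → Prop} [h : Dfn N P] [h' : Dfn N Q] : Dfn N (fun c => P c ∧ Q c) :=
  (inferInstance : Dfn N (fun c => ¬ (P c → ¬ Q c))).congr fun c => by tauto

instance Dfn.or {P Q : γ → Prop} [h : Dfn N P] [h' : Dfn N Q] : Dfn N (fun c => P c ∨ Q c) :=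
  (inferInstance : Dfn N (fun c => ¬ P c → Q c)).congr fun c => by tauto

instance Dfn.iff {P Q : γ → Prop} [h : Dfn N P] [h' : Dfn N Q] : Dfn N (fun c => P c ↔ Q c) :=
  (inferInstance : Dfn N (fun c => (P c → Q c) ∧ (Q c → P c))).congr fun c => by tauto

instance Dfn.ne {t s : γ → N} [h : Dfn N (fun c => t c = s c)] : Dfn N (fun c => t c ≠ s c) :=
  Dfn.not

instance Dfn.ex {P : γ → N → Prop} [h : Dfn N (fun p : γ × N => P p.1 p.2)] :
    Dfn N (fun c => ∃ x, P c x) :=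
  (inferInstance : Dfn N (fun c => ¬ ∀ x, ¬ P c x)).congr fun c => by simp

instance Dfn.allFin {k : ℕ} {P : Fin k → γ → Prop} [h : ∀ i, Dfn N (P i)] :
    Dfn N (fun c => ∀ i, P i c) := by
  choose φ hφ using fun i => (h i).out
  exact ⟨BoundedFormula.iInf φ, fun c => by simp [hφ]⟩

/-- Definability is preserved by substituting variables and parameters for variables. -/
theorem Dfn.reindex {δ : Type u} [Ctx N δ] {P : δ → Prop} (h : Dfn N P) (f : γ → δ)
    (hf : IsCtxMap (N := N) f) : Dfn N (fun c => P (f c)) := by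
  obtain ⟨φ, hφ⟩ := h
  choose g hg using hf
  -- All variables of `φ` are made free, so that each one can be replaced by a parameter or by a
  -- variable of the new context.
  refine ⟨BoundedFormula.relabel (n := Ctx.size N γ) (k := 0)
    (Sum.elim Sum.inl g) φ.toFormula, fun c => ?_⟩
  rw [← hφ, BoundedFormula.realize_relabel,
    Subsingleton.elim (Ctx.env c ∘ Fin.natAdd (Ctx.size N γ) : Fin 0 → N) default]
  refine (BoundedFormula.realize_toFormula (M := N) φ
    (Sum.elim id (Ctx.env c ∘ Fin.castAdd 0) ∘ Sum.elim Sum.inl g)).trans ?_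
  have : (Ctx.env (f c) : Fin (Ctx.size N δ) → N) = fun i => Sum.elim id (Ctx.env c) (g i) :=
    funext fun i => hg i c
  rw [this]
  exact Iff.rfl

theorem IsAtom.dfn_mem {t s : γ → N} (ht : IsAtom N t) (hs : IsAtom N s) :
    Dfn N (fun c => Mem (t c) (s c)) := by
  obtain ⟨i, hi⟩ := ht
  obtain ⟨j, hj⟩ := hs
  refine ⟨memF (.var i) (.var j), fun c => ?_⟩
  rw [memF, BoundedFormula.realize_rel₂, Mem, hi, hj]
  rfl

theorem IsAtom.dfn_eq {t s : γ → N} (ht : IsAtom N t) (hs : IsAtom N s) :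
    Dfn N (fun c => t c = s c) := by
  obtain ⟨i, hi⟩ := ht
  obtain ⟨j, hj⟩ := hs
  refine ⟨(Language.Term.var i).bdEqual (.var j), fun c => ?_⟩
  rw [BoundedFormula.realize_bdEqual, hi, hj]
  rfl

theorem IsAtom.dFun {t : γ → N} (h : IsAtom N t) : DFun N t := ⟨last.dfn_eq h.weaken⟩

/-- Contexts are nested pairs, so a variable is a de Bruijn index: a projection. Depth eight is
needed by Tarski's clauses, which put four quantified variables on top of their four arguments. -/
instance (a : N) : DFun N (fun _ : γ => a) := (IsAtom.const a).dFun
instance : DFun N (fun p : γ × N => p.2) := IsAtom.last.dFun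
instance : DFun N (fun p : (γ × N) × N => p.1.2) := IsAtom.last.weaken.dFun
instance : DFun N (fun p : ((γ × N) × N) × N => p.1.1.2) := IsAtom.last.weaken.weaken.dFun
instance : DFun N (fun p : (((γ × N) × N) × N) × N => p.1.1.1.2) :=
  IsAtom.last.weaken.weaken.weaken.dFun
instance : DFun N (fun p : ((((γ × N) × N) × N) × N) × N => p.1.1.1.1.2) :=
  IsAtom.last.weaken.weaken.weaken.weaken.dFun
instance : DFun N (fun p : (((((γ × N) × N) × N) × N) × N) × N => p.1.1.1.1.1.2) :=
  IsAtom.last.weaken.weaken.weaken.weaken.weaken.dFun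
instance : DFun N (fun p : ((((((γ × N) × N) × N) × N) × N) × N) × N => p.1.1.1.1.1.1.2) :=
  IsAtom.last.weaken.weaken.weaken.weaken.weaken.weaken.dFun
instance :
    DFun N (fun p : (((((((γ × N) × N) × N) × N) × N) × N) × N) × N => p.1.1.1.1.1.1.1.2) :=
  IsAtom.last.weaken.weaken.weaken.weaken.weaken.weaken.weaken.dFun

theorem DFun.weaken {t : γ → N} (h : DFun N t) : DFun N (fun p : γ × N => t p.1) :=
  ⟨h.out.reindex (fun p : (γ × N) × N => (p.1.1, p.2)) (IsCtxMap.fst_fst.prod IsAtom.last)⟩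

/-- Definability is preserved by substituting definable functions for variables. -/
theorem Dfn.subst {P : γ → N → Prop} {x : γ → N} (hx : DFun N x)
    (h : Dfn N (fun p : γ × N => P p.1 p.2)) : Dfn N (fun c => P c (x c)) := by
  have := hx.out
  exact (inferInstance : Dfn N (fun c => ∃ z, z = x c ∧ P c z)).congr fun c => by simp

theorem Dfn.subst₂ {P : γ → N → N → Prop} {x y : γ → N} (hx : DFun N x) (hy : DFun N y)
    (h : Dfn N (fun p : (γ × N) × N => P p.1.1 p.1.2 p.2)) : Dfn N (fun c => P c (x c) (y c)) :=
  Dfn.subst (P := fun c a => P c a (y c)) hx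
    (Dfn.subst (P := fun (p : γ × N) b => P p.1 p.2 b) hy.weaken h)

theorem Dfn.subst₃ {P : γ → N → N → N → Prop} {x y z : γ → N} (hx : DFun N x) (hy : DFun N y)
    (hz : DFun N z) (h : Dfn N (fun p : ((γ × N) × N) × N => P p.1.1.1 p.1.1.2 p.1.2 p.2)) :
    Dfn N (fun c => P c (x c) (y c) (z c)) :=
  Dfn.subst (P := fun c a => P c a (y c) (z c)) hx
    (Dfn.subst₂ (P := fun (p : γ × N) b d => P p.1 p.2 b d) hy.weaken hz.weaken h)

instance {t s : γ → N} [ht : DFun N t] [hs : DFun N s] : Dfn N (fun c => Mem (t c) (s c)) :=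
  Dfn.subst₂ (P := fun _ => Mem) ht hs (IsAtom.last.weaken.dfn_mem IsAtom.last)

instance {t s : γ → N} [ht : DFun N t] [hs : DFun N s] : Dfn N (fun c => t c = s c) :=
  Dfn.subst₂ (P := fun _ => Eq) ht hs (IsAtom.last.weaken.dfn_eq IsAtom.last)

variable (N) in
/-- A binary relation on `N` that is definable with parameters. -/
structure DRel₂ where
  /-- The relation. -/
  rel : N → N → Prop
  dfn : Dfn N (fun p : (PUnit.{u + 1} × N) × N => rel p.1.2 p.2)

variable (N) in
/-- A quaternary relation on `N` that is definable with parameters. -/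
structure DRel₄ where
  /-- The relation. -/
  rel : N → N → N → N → Prop
  dfn : Dfn N (fun p : (((PUnit.{u + 1} × N) × N) × N) × N => rel p.1.1.1.2 p.1.1.2 p.1.2 p.2)

/-- A bundled relation behaves like an atomic formula in the search for definability instances,
whatever its definition. -/
instance (R : DRel₂ N) {x y : γ → N} [hx : DFun N x] [hy : DFun N y] :
    Dfn N (fun c => R.rel (x c) (y c)) :=
  Dfn.subst₂ (P := fun _ => R.rel) hx hy (R.dfn.reindex
    (fun p : (γ × N) × N => ((PUnit.unit, p.1.2), p.2))
    ((IsCtxMap.unit.prod IsAtom.last.weaken).prod IsAtom.last))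

instance (R : DRel₄ N) {x y z w : γ → N} [hx : DFun N x] [hy : DFun N y] [hz : DFun N z]
    [hw : DFun N w] : Dfn N (fun c => R.rel (x c) (y c) (z c) (w c)) :=
  Dfn.subst₃ (P := fun c a b d => R.rel a b d (w c)) hx hy hz
    (Dfn.subst (P := fun (p : ((γ × N) × N) × N) d => R.rel p.1.1.2 p.1.2 p.2 d)
      hw.weaken.weaken.weaken
      (R.dfn.reindex (fun p : (((γ × N) × N) × N) × N =>
          ((((PUnit.unit, p.1.1.1.2), p.1.1.2), p.1.2), p.2))
        ((((IsCtxMap.unit.prod IsAtom.last.weaken.weaken.weaken).prod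
          IsAtom.last.weaken.weaken).prod IsAtom.last.weaken).prod IsAtom.last)))

end Definability
/-! ### Set theory in a model of ZFC -/

section SetTheory

open FirstOrder.Language

variable {N : Type u} [LSet.Structure N]

theorem realize_memF {α : Type v} {n : ℕ} {t s : LSet.Term (α ⊕ Fin n)} {v : α → N}
    {xs : Fin n → N} : (memF t s).Realize v xs ↔
      Mem (t.realize (Sum.elim v xs)) (s.realize (Sum.elim v xs)) :=
  BoundedFormula.realize_rel₂

theorem realize_place {k n : ℕ} {φ : LSet.Formula (Fin k)} {g : Fin k → Fin n} {v : Empty → N}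
    {xs : Fin n → N} : (place φ g).Realize v xs ↔ φ.Realize (xs ∘ g) := by
  refine (BoundedFormula.realize_relabel (n := 0)).trans ?_
  rw [Formula.Realize, Subsingleton.elim (xs ∘ Fin.natAdd n : Fin 0 → N) default]
  rfl

/-- Only finitely many parameters occur in a formula. Listing them as a tuple gives the shape in
which the Separation scheme is stated. -/
theorem Dfn.exists_formula {P : N → Prop} (h : Dfn N (fun c : PUnit.{u + 1} × N => P c.2)) :
    ∃ (n : ℕ) (ψ : LSet.Formula (Fin (n + 1))) (p : Fin n → N),
      ∀ x, ψ.Realize (Fin.snoc p x : Fin (n + 1) → N) ↔ P x := by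
  classical
  obtain ⟨φ, hφ⟩ := h
  change LSet.BoundedFormula N 1 at φ
  let f := φ.freeVarFinset.equivFin
  refine ⟨_, (φ.restrictFreeVar f).toFormula.relabel
    (Sum.elim Fin.castSucc fun _ => Fin.last _), fun i => f.symm i, fun x => ?_⟩
  rw [Formula.realize_relabel, BoundedFormula.realize_toFormula,
    BoundedFormula.realize_restrictFreeVar (v' := id) (by simp), ← hφ (PUnit.unit, x)]
  set p' : Fin φ.freeVarFinset.card → N := fun i => f.symm i
  refine iff_of_eq (congrArg _ (funext fun i => ?_))
  rw [Subsingleton.elim i (Fin.last 0)]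
  exact (Fin.snoc_last (n := _) (α := fun _ => N) x p').trans
    (Fin.snoc_last (n := 0) (α := fun _ => N) x Fin.elim0).symm

variable [N ⊨ ZFC]

theorem Mem.ext {x y : N} (h : ∀ z, Mem z x ↔ Mem z y) : x = y := by
  have := ZFC.realize_sentence_of_mem (M := N) (φ := extensionality) (by simp [ZFC])
  simp only [extensionality, Sentence.Realize, Formula.Realize, BoundedFormula.realize_all,
    BoundedFormula.realize_imp, BoundedFormula.realize_iff, realize_memF,
    BoundedFormula.realize_bdEqual] at this
  exact this x y h

theorem exists_sep (P : N → Prop) (a : N)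
    (h : Dfn N (fun c : PUnit.{u + 1} × N => P c.2) := by infer_instance) :
    ∃ b, ∀ x, Mem x b ↔ Mem x a ∧ P x := by
  obtain ⟨n, ψ, p, hψ⟩ := h.exists_formula
  have := ZFC.realize_sentence_of_mem (M := N) (φ := separation ψ)
    (.inl (.inr ⟨n, ψ, rfl⟩))
  have hp := BoundedFormula.realize_alls.1 this p
  simp only [BoundedFormula.realize_all, BoundedFormula.realize_ex, BoundedFormula.realize_inf,
    BoundedFormula.realize_iff, realize_memF, realize_place] at hp
  obtain ⟨b, hb⟩ := hp a
  refine ⟨b, fun x => ?_⟩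
  have hx := hb x
  -- The axiom evaluates `ψ` in the environment `(p, a, b, x)`; the relabelling skips `a` and `b`.
  have he : (Fin.snoc (Fin.snoc (Fin.snoc p a) b) x : Fin (n + 3) → N) ∘
      Fin.snoc (fun i => ⟨i, by omega⟩) ⟨n + 2, by omega⟩ = (Fin.snoc p x : Fin (n + 1) → N) := by
    funext i
    refine Fin.lastCases ?_ (fun i => ?_) i
    · simp [Fin.snoc]
    · have hi := i.2
      simp only [Fin.snoc, Function.comp_apply, Fin.val_castSucc, Fin.val_castLT, hi,
        show (i : ℕ) < n + 1 by omega, show (i : ℕ) < n + 2 by omega, dite_true, cast_eq]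
      rfl
  rw [← hψ x]
  simp only [he] at hx
  simpa [Fin.snoc] using hx

theorem exists_pairing (x y : N) : ∃ p, ∀ z, Mem z p ↔ z = x ∨ z = y := by
  have := ZFC.realize_sentence_of_mem (M := N) (φ := pairing) (by simp [ZFC])
  simp only [pairing, Sentence.Realize, Formula.Realize, BoundedFormula.realize_all,
    BoundedFormula.realize_ex, BoundedFormula.realize_sup, BoundedFormula.realize_iff,
    realize_memF, BoundedFormula.realize_bdEqual] at this
  exact this x y

theorem exists_union (x : N) : ∃ u, ∀ z, Mem z u ↔ ∃ y, Mem y x ∧ Mem z y := by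
  have := ZFC.realize_sentence_of_mem (M := N) (φ := union) (by simp [ZFC])
  simp only [union, Sentence.Realize, Formula.Realize, BoundedFormula.realize_all,
    BoundedFormula.realize_ex, BoundedFormula.realize_inf, BoundedFormula.realize_iff,
    realize_memF] at this
  exact this x

theorem exists_powerset (x : N) : ∃ p, ∀ z, Mem z p ↔ ∀ y, Mem y z → Mem y x := by
  have := ZFC.realize_sentence_of_mem (M := N) (φ := powerset) (by simp [ZFC])
  simp only [powerset, Sentence.Realize, Formula.Realize, BoundedFormula.realize_all,
    BoundedFormula.realize_ex, BoundedFormula.realize_imp, BoundedFormula.realize_iff,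
    realize_memF] at this
  exact this x

theorem exists_foundation (x : N) (h : ∃ y, Mem y x) : ∃ y, Mem y x ∧ ∀ z, Mem z y → ¬ Mem z x := by
  have := ZFC.realize_sentence_of_mem (M := N) (φ := foundation) (by simp [ZFC])
  simp only [foundation, Sentence.Realize, Formula.Realize, BoundedFormula.realize_all,
    BoundedFormula.realize_ex, BoundedFormula.realize_inf, BoundedFormula.realize_not,
    BoundedFormula.realize_imp, realize_memF] at this
  exact this x h


/-- The unordered pair `{x, y}` in `N`. -/
noncomputable def upair (x y : N) : N := (exists_pairing x y).choose

@[simp] theorem mem_upair {x y z : N} : Mem z (upair x y) ↔ z = x ∨ z = y :=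
  (exists_pairing x y).choose_spec z

/-- The union of a set in `N`. -/
noncomputable def sUnion (x : N) : N := (exists_union x).choose

@[simp] theorem mem_sUnion {x z : N} : Mem z (sUnion x) ↔ ∃ y, Mem y x ∧ Mem z y :=
  (exists_union x).choose_spec z

/-- The union of two sets in `N`. -/
noncomputable def cup (x y : N) : N := sUnion (upair x y)

@[simp] theorem mem_cup {x y z : N} : Mem z (cup x y) ↔ Mem z x ∨ Mem z y := by simp [cup]

/-- The successor `x ∪ {x}` in `N`. -/
noncomputable def succ (x : N) : N := cup x (upair x x)

@[simp] theorem mem_succ {x z : N} : Mem z (succ x) ↔ Mem z x ∨ z = x := by simp [succ]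

theorem isSuccOf_iff {x y : N} : IsSuccOf Mem y x ↔ y = succ x :=
  ⟨fun h => Mem.ext fun z => (h z).trans mem_succ.symm, fun h _ => h ▸ mem_succ⟩

/-- The Kuratowski pair in `N`. -/
noncomputable def pr (x y : N) : N := upair (upair x x) (upair x y)

theorem eq_upair_iff {x y z : N} : z = upair x y ↔ ∀ t, Mem t z ↔ t = x ∨ t = y :=
  ⟨fun h _ => h ▸ mem_upair, fun h => Mem.ext fun t => (h t).trans mem_upair.symm⟩

theorem isPair_iff {q x y : N} : IsPair q x y ↔ q = pr x y := by
  simp only [IsPair, pr, eq_upair_iff, or_self]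

theorem upair_inj_right {x y z : N} (h : upair x y = upair x z) : y = z := by
  rw [eq_upair_iff] at h
  simp only [mem_upair] at h
  have h1 := h y
  have h2 := h z
  grind

@[simp] theorem pr_inj {x y x' y' : N} : pr x y = pr x' y' ↔ x = x' ∧ y = y' := by
  refine ⟨fun h => ?_, fun h => by rw [h.1, h.2]⟩
  have hx : x = x' := by
    have h1 : Mem (upair x x) (pr x' y') := h ▸ by simp [pr]
    rw [pr, mem_upair, eq_upair_iff, eq_upair_iff] at h1
    simp only [mem_upair, or_self] at h1
    rcases h1 with h1 | h1
    · exact (h1 x).1 rfl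
    · exact ((h1 x').2 (.inl rfl)).symm
  subst hx
  exact ⟨rfl, upair_inj_right (upair_inj_right h)⟩

/-- The power set in `N`. -/
noncomputable def pow (x : N) : N := (exists_powerset x).choose

@[simp] theorem mem_pow {x z : N} : Mem z (pow x) ↔ ∀ y, Mem y z → Mem y x :=
  (exists_powerset x).choose_spec z

theorem not_mem_self (x : N) : ¬ Mem x x := by
  intro h
  obtain ⟨y, hy, hz⟩ := exists_foundation (upair x x) ⟨x, by simp⟩
  simp only [mem_upair, or_self] at hy hz
  subst hy
  exact hz _ h rfl

section Instances

variable {γ : Type u} [Ctx N γ] {x y : γ → N} [hx : DFun N x] [hy : DFun N y]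

instance : DFun N (fun c => upair (x c) (y c)) := by
  have := hx.weaken.weaken
  have := hy.weaken.weaken
  exact ⟨(inferInstance : Dfn N (fun p : γ × N => ∀ t, Mem t p.2 ↔ t = x p.1 ∨ t = y p.1)).congr
    fun c => eq_upair_iff⟩

instance : DFun N (fun c => pr (x c) (y c)) :=
  (inferInstance : DFun N (fun c => upair (upair (x c) (x c)) (upair (x c) (y c))))

instance : DFun N (fun c => succ (x c)) := by
  have := hx.weaken.weaken
  exact ⟨(inferInstance : Dfn N (fun p : γ × N => ∀ t, Mem t p.2 ↔ Mem t (x p.1) ∨ t = x p.1)).congr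
    fun c => isSuccOf_iff.symm⟩

end Instances

/-- Kuratowski pairs of elements of `a` and `b` are sets of subsets of `a ∪ b`, so Separation from
the double power set suffices. -/
theorem exists_prod (a b : N) : ∃ p : N, ∀ q, Mem q p ↔ ∃ x y, Mem x a ∧ Mem y b ∧ q = pr x y := by
  obtain ⟨p, hp⟩ := exists_sep (fun q => ∃ x y, Mem x a ∧ Mem y b ∧ q = pr x y)
    (pow (pow (cup a b)))
  refine ⟨p, fun q => (hp q).trans (and_iff_right_of_imp ?_)⟩
  rintro ⟨x, y, hx, hy, rfl⟩
  simp only [pr, mem_pow, mem_upair, mem_cup]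
  rintro z (rfl | rfl) t ht <;> simp only [mem_upair] at ht <;> grind

/-- The cartesian product in `N`. -/
noncomputable def prod (a b : N) : N := (exists_prod a b).choose

theorem mem_prod {a b q : N} : Mem q (prod a b) ↔ ∃ x y, Mem x a ∧ Mem y b ∧ q = pr x y :=
  (exists_prod a b).choose_spec q

@[simp] theorem pr_mem_prod {a b x y : N} : Mem (pr x y) (prod a b) ↔ Mem x a ∧ Mem y b := by
  simp [mem_prod]

theorem IsOmega.succ_mem {ω : N} (hω : IsOmega Mem ω) {x : N} (hx : Mem x ω) : Mem (succ x) ω := by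
  obtain ⟨z, hz, h⟩ := hω.1.2 x hx
  exact isSuccOf_iff.1 hz ▸ h

variable [Nonempty N]

variable (N) in
theorem exists_emp : ∃ x : N, ∀ z, ¬ Mem z x := by
  obtain ⟨b, hb⟩ := exists_sep (fun _ : N => False) (Classical.arbitrary N)
  exact ⟨b, fun z hz => ((hb z).1 hz).2⟩

/-- The empty set of `N`. -/
noncomputable def emp : N := (exists_emp N).choose

@[simp] theorem not_mem_emp {z : N} : ¬ Mem z emp := (exists_emp N).choose_spec z

theorem isEmptySet_iff {x : N} : IsEmptySet Mem x ↔ x = emp :=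
  ⟨fun h => Mem.ext fun z => by simp [h z], fun h z => h ▸ not_mem_emp⟩

/-! ### Numerals and `ω` -/

/-- The numerals of `N`. -/
noncomputable def num : ℕ → N
  | 0 => emp
  | n + 1 => succ (num n)

theorem isNumeral_iff {n : ℕ} {x : N} : IsNumeral Mem n x ↔ x = num n := by
  induction n generalizing x with
  | zero => exact isEmptySet_iff
  | succ n ih => simp [IsNumeral, ih, isSuccOf_iff, num]

theorem mem_num {n : ℕ} {x : N} : Mem x (num n) ↔ ∃ k < n, x = num k := by
  induction n with
  | zero => simp [num]
  | succ n ih =>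
    rw [num, mem_succ, ih]
    constructor
    · rintro (⟨k, hk, rfl⟩ | rfl)
      · exact ⟨k, by omega, rfl⟩
      · exact ⟨n, by omega, rfl⟩
    · rintro ⟨k, hk, rfl⟩
      rcases Nat.lt_succ_iff_lt_or_eq.1 hk with h | rfl
      · exact .inl ⟨k, h, rfl⟩
      · exact .inr rfl

theorem num_injective : Function.Injective (num : ℕ → N) := by
  intro a b h
  rcases lt_trichotomy a b with hab | hab | hab
  · exact (not_mem_self (num b : N) (mem_num.2 ⟨a, hab, h.symm⟩)).elim
  · exact hab
  · exact (not_mem_self (num a : N) (mem_num.2 ⟨b, hab, h⟩)).elim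

@[simp] theorem num_inj {a b : ℕ} : (num a : N) = num b ↔ a = b := num_injective.eq_iff

@[simp] theorem num_mem_num {a b : ℕ} : Mem (num a : N) (num b) ↔ a < b := by
  simp [mem_num]

theorem emp_eq : (emp : N) = num 0 := rfl

theorem succ_num (n : ℕ) : succ (num n : N) = num (n + 1) := rfl

section Omega

variable {ω : N}

theorem IsOmega.emp_mem (hω : IsOmega Mem ω) : Mem emp ω := by
  obtain ⟨z, hz, h⟩ := hω.1.1
  exact isEmptySet_iff.1 hz ▸ h

theorem IsOmega.num_mem (hω : IsOmega Mem ω) (n : ℕ) : Mem (num n) ω := by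
  induction n with
  | zero => exact hω.emp_mem
  | succ n ih => exact hω.succ_mem ih

/-- Induction in `N` for definable predicates. -/
theorem IsOmega.induction (hω : IsOmega Mem ω) (P : N → Prop) (h0 : P emp)
    (hs : ∀ x, Mem x ω → P x → P (succ x)) (x : N) (hx : Mem x ω)
    (h : Dfn N (fun c : PUnit.{u + 1} × N => P c.2) := by infer_instance) : P x := by
  obtain ⟨b, hb⟩ := exists_sep P ω
  refine ((hb x).1 (hω.2 b ⟨⟨emp, isEmptySet_iff.2 rfl, (hb _).2 ⟨hω.emp_mem, h0⟩⟩, ?_⟩ x hx)).2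
  intro y hy
  obtain ⟨hy, hP⟩ := (hb y).1 hy
  exact ⟨succ y, isSuccOf_iff.2 rfl, (hb _).2 ⟨hω.succ_mem hy, hs y hy hP⟩⟩

/-- Being a numeral is not a definable notion, so the induction on `n` is external. Each of its
steps is an induction on `x` inside `N`, for a predicate that mentions only fixed numerals. -/
theorem IsOmega.trichotomy (hω : IsOmega Mem ω) (n : ℕ) (x : N) (hx : Mem x ω) :
    Mem (num n) x ∨ ∃ k ≤ n, x = num k := by
  induction n generalizing x with
  | zero =>
    refine (hω.induction (fun x => Mem (num 0) x ∨ x = num 0) (.inr rfl) ?_ x hx).imp_right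
      fun h => ⟨0, le_rfl, h⟩
    rintro x - (h | rfl)
    · exact .inl (mem_succ.2 (.inl h))
    · exact .inl (mem_succ.2 (.inr rfl))
  | succ n ih =>
    have : ∀ x, Mem x ω → Mem (num n) x → Mem (num (n + 1)) x ∨ x = num (n + 1) := by
      refine fun x hx => hω.induction
        (fun x => Mem (num n) x → Mem (num (n + 1)) x ∨ x = num (n + 1))
        (fun h => (not_mem_emp h).elim) ?_ x hx
      intro x hx h1 h2
      rcases mem_succ.1 h2 with h | rfl
      · rcases h1 h with h | rfl
        · exact .inl (mem_succ.2 (.inl h))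
        · exact .inl (mem_succ.2 (.inr rfl))
      · exact .inr rfl
    rcases ih x hx with h | ⟨k, hk, rfl⟩
    · exact (this x hx h).imp_right fun h => ⟨n + 1, le_rfl, h⟩
    · exact .inr ⟨k, by omega, rfl⟩

/-- A definable predicate that holds of all numerals holds of a nonstandard element of `ω`. -/
theorem IsOmega.overspill (hω : IsOmega Mem ω) (hns : ∃ x : N, Mem x ω ∧ ∀ n, x ≠ num n)
    (P : N → Prop) (hP : ∀ n, P (num n))
    (h : Dfn N (fun c : PUnit.{u + 1} × N => P c.2) := by infer_instance) :
    ∃ d, Mem d ω ∧ P d ∧ ∀ n, Mem (num n) d := by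
  by_contra! hcon
  have hstd : ∀ d, Mem d ω → P d → ∃ k, d = num k := fun d hd hPd => by
    obtain ⟨n, hn⟩ := hcon d hd hPd
    obtain ⟨k, -, hk⟩ := (hω.trichotomy n d hd).resolve_left hn
    exact ⟨k, hk⟩
  obtain ⟨x, hx, hxn⟩ := hns
  -- Were `P` true of no nonstandard element of `ω`, it would define the standard cut, which
  -- contains `∅` and is closed under successor; induction in `N` would put `x` into it.
  obtain ⟨k, hk⟩ := hstd x hx (hω.induction P (hP 0) (fun y hy hPy => by
    obtain ⟨k, rfl⟩ := hstd y hy hPy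
    exact hP (k + 1)) x hx)
  exact hxn k hk

/-- Minimality rules out nonstandard `y`: by trichotomy they contain `num n`, which already
satisfies `P`. Hence the behaviour of `P` at nonstandard arguments is harmless. -/
theorem IsOmega.least_iff (hω : IsOmega Mem ω) {P : N → Prop} {n : ℕ} (hn : P (num n))
    (hlt : ∀ k < n, ¬ P (num k)) (y : N) :
    (Mem y ω ∧ P y ∧ ∀ k, Mem k y → ¬ P k) ↔ y = num n := by
  constructor
  · rintro ⟨hy, hPy, hk⟩
    rcases hω.trichotomy n y hy with h | ⟨k, hkn, rfl⟩
    · exact (hk _ h hn).elim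
    · rcases hkn.lt_or_eq with h | rfl
      · exact (hlt k h hPy).elim
      · rfl
  · rintro rfl
    refine ⟨hω.num_mem n, hn, fun k hk => ?_⟩
    obtain ⟨k, hkn, rfl⟩ := mem_num.1 hk
    exact hlt k hkn

end Omega

end SetTheory
/-! ### Iteration of definable steps -/

section Iteration

variable {N : Type u} [LSet.Structure N] [N ⊨ ZFC] [Nonempty N]

/-- Some set function that starts with `x₀` and follows the step relation `S` below `n` has the
value `y` at `n`. -/
def Iter (S : DRel₄ N) (a x₀ n y : N) : Prop :=
  ∃ f, (∀ z, Mem (pr emp z) f ↔ z = x₀) ∧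
    (∀ k, Mem k n → ∀ x, Mem (pr k x) f → ∀ z, Mem (pr (succ k) z) f ↔ S.rel a k x z) ∧
    Mem (pr n y) f

instance {γ : Type u} [Ctx N γ] (S : DRel₄ N) {a x₀ n y : γ → N} [ha : DFun N a] [hx : DFun N x₀]
    [hn : DFun N n] [hy : DFun N y] : Dfn N (fun c => Iter S (a c) (x₀ c) (n c) (y c)) := by
  have := ha.weaken.weaken.weaken.weaken
  have := hx.weaken.weaken
  have := hn.weaken
  have := hn.weaken.weaken
  have := hy.weaken
  unfold Iter
  infer_instance

theorem exists_finite_seq (s : ℕ → N) (n : ℕ) :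
    ∃ f, ∀ q, Mem q f ↔ ∃ k ≤ n, q = pr (num k) (s k) := by
  induction n with
  | zero => exact ⟨upair (pr (num 0) (s 0)) (pr (num 0) (s 0)), fun q => by simp⟩
  | succ n ih =>
    obtain ⟨f, hf⟩ := ih
    let q' : N := pr (num (n + 1)) (s (n + 1))
    refine ⟨cup f (upair q' q'), fun q => ?_⟩
    rw [mem_cup, hf, mem_upair, or_self]
    constructor
    · rintro (⟨k, hk, rfl⟩ | rfl)
      · exact ⟨k, by omega, rfl⟩
      · exact ⟨n + 1, le_rfl, rfl⟩
    · rintro ⟨k, hk, rfl⟩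
      rcases Nat.le_succ_iff.1 hk with h | rfl
      · exact .inl ⟨k, h, rfl⟩
      · exact .inr rfl

/-- The step relation has to be functional only along `s`. External induction forces the values of
any witness `f` at numerals up to `n`, and `exists_finite_seq` supplies a witness. -/
theorem iter_num_iff {S : DRel₄ N} {a : N} {s : ℕ → N} {n : ℕ}
    (h : ∀ k < n, ∀ y, S.rel a (num k) (s k) y ↔ y = s (k + 1)) (y : N) :
    Iter S a (s 0) (num n) y ↔ y = s n := by
  constructor
  · rintro ⟨f, h0, hs, hy⟩
    have key : ∀ k ≤ n, ∀ z, Mem (pr (num k) z) f ↔ z = s k := by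
      intro k
      induction k with
      | zero => exact fun _ => h0
      | succ k ih =>
        intro hk z
        exact (hs (num k) (num_mem_num.2 hk) (s k) ((ih (by omega) _).2 rfl) z).trans (h k hk z)
    exact (key n le_rfl y).1 hy
  · rintro rfl
    obtain ⟨f, hf⟩ := exists_finite_seq s n
    have key : ∀ k ≤ n, ∀ z, Mem (pr (num k) z) f ↔ z = s k := by
      intro k hk z
      rw [hf]
      constructor
      · rintro ⟨j, -, h⟩
        obtain ⟨h1, rfl⟩ := pr_inj.1 h
        rw [num_injective h1]
      · rintro rfl
        exact ⟨k, hk, rfl⟩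
    refine ⟨f, key 0 (by omega), fun k hk x hx z => ?_, (key n le_rfl _).2 rfl⟩
    obtain ⟨k, hkn, rfl⟩ := mem_num.1 hk
    obtain rfl := (key k hkn.le x).1 hx
    exact (key (k + 1) hkn z).trans (h k hkn z).symm

end Iteration

/-! ### Representation of partial recursive functions -/

section Representation

variable {N : Type u} [LSet.Structure N] [N ⊨ ZFC] [Nonempty N]

/-- One step in the enumeration of pairs of natural numbers by `Nat.unpair`. -/
def unpairStep : DRel₄ N where
  rel _ _ q q' := ∃ a b, q = pr a b ∧
    ((Mem a b ∧ ((Mem (succ a) b ∧ q' = pr (succ a) b) ∨ (succ a = b ∧ q' = pr b emp))) ∨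
      (a = b ∧ q' = pr emp (succ a)) ∨ (Mem b a ∧ q' = pr a (succ b)))
  dfn := inferInstance

/-- `q` is the pair that `Nat.unpair` assigns to `n`. -/
def Unpair (n q : N) : Prop := Iter unpairStep emp (pr emp emp) n q

instance {γ : Type u} [Ctx N γ] {n q : γ → N} [DFun N n] [DFun N q] :
    Dfn N (fun c => Unpair (n c) (q c)) := by
  unfold Unpair; infer_instance

/-- `Nat.pair` runs through the shells of constant maximum `b`: first `(0, b), …, (b - 1, b)`, then
`(b, 0), …, (b, b)`, then on to `(0, b + 1)`. The disjuncts of `unpairStep` are these moves, so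
pairs are decoded without defining arithmetic in `N`. -/
theorem unpairStep_iff (n : ℕ) (k x y : N) :
    unpairStep.rel k x (pr (num n.unpair.1) (num n.unpair.2)) y ↔
      y = pr (num (n + 1).unpair.1) (num (n + 1).unpair.2) := by
  obtain ⟨a, b, rfl⟩ : ∃ a b, n = Nat.pair a b := ⟨_, _, n.pair_unpair.symm⟩
  have key : ∀ a' b', Nat.pair a b + 1 = Nat.pair a' b' →
      (Nat.pair a b + 1).unpair = (a', b') := fun a' b' h => by rw [h, Nat.unpair_pair]
  simp only [unpairStep, Nat.unpair_pair, pr_inj]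
  have hex : ∀ Q : N → N → Prop, (∃ a' b', ((num a : N) = a' ∧ (num b : N) = b') ∧ Q a' b') ↔
      Q (num a) (num b) := fun Q =>
    ⟨by rintro ⟨_, _, ⟨rfl, rfl⟩, h⟩; exact h, fun h => ⟨_, _, ⟨rfl, rfl⟩, h⟩⟩
  rw [hex]
  simp only [succ_num, num_mem_num, num_inj, emp_eq]
  rcases lt_trichotomy a b with h | h | h
  · rcases lt_or_eq_of_le (Nat.succ_le_of_lt h) with h' | h'
    · rw [key (a + 1) b (by simp only [Nat.pair]; split_ifs <;> grind)]
      simp only [Nat.succ_eq_add_one] at h'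
      simp [h, h', h.ne, h'.ne, h.not_gt]
    · rw [key b 0 (by subst h'; simp only [Nat.pair]; split_ifs <;> grind)]
      subst h'
      simp
  · subst h
    rw [key 0 (a + 1) (by simp only [Nat.pair]; split_ifs <;> grind)]
    simp
  · rw [key a (b + 1) (by simp only [Nat.pair]; split_ifs <;> grind)]
    simp [h, h.not_gt, h.ne']

theorem unpair_num_iff (n : ℕ) (q : N) :
    Unpair (num n) q ↔ q = pr (num n.unpair.1) (num n.unpair.2) := by
  have := iter_num_iff (S := unpairStep (N := N)) (a := emp) (n := n)
    (s := fun n => pr (num n.unpair.1) (num n.unpair.2)) (fun k _ => unpairStep_iff k _ _) q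
  simpa [Unpair, emp_eq] using this

/-- `n` is the code of the pair of `a` and `b`. -/
def PairCode (ω a b n : N) : Prop :=
  Mem n ω ∧ Unpair n (pr a b) ∧ ∀ k, Mem k n → ¬ Unpair k (pr a b)

instance {γ : Type u} [Ctx N γ] {ω a b n : γ → N} [DFun N ω] [ha : DFun N a] [hb : DFun N b]
    [hn : DFun N n] : Dfn N (fun c => PairCode (ω c) (a c) (b c) (n c)) := by
  have := ha.weaken
  have := hb.weaken
  have := hn.weaken
  unfold PairCode; infer_instance

variable {ω : N}

theorem IsOmega.pairCode_iff (hω : IsOmega Mem ω) (a b : ℕ) (n : N) :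
    PairCode ω (num a) (num b) n ↔ n = num (Nat.pair a b) :=
  hω.least_iff (P := fun n => Unpair n (pr (num a) (num b)))
    ((unpair_num_iff _ _).2 (by simp)) (fun k hk h => by
      rw [unpair_num_iff, pr_inj, num_inj, num_inj] at h
      rw [h.1, h.2, Nat.pair_unpair] at hk
      exact lt_irrefl _ hk) n

variable (N) in
/-- The partial function `f` agrees, where it is defined, with a definable relation of `N`. -/
def Representable (f : ℕ →. ℕ) : Prop :=
  ∃ R : DRel₂ N, ∀ n m, m ∈ f n → ∀ y, R.rel (num n) y ↔ y = num m

/-- Induction on the construction of `f`: primitive recursion becomes `Iter`, and minimization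
becomes a least witness, controlled by `IsOmega.least_iff`. -/
theorem IsOmega.representable (hω : IsOmega Mem ω) {f : ℕ →. ℕ} (hf : Nat.Partrec f) :
    Representable N f := by
  induction hf with
  | zero =>
    refine ⟨⟨fun _ y => y = emp, inferInstance⟩, fun n m hm y => ?_⟩
    obtain rfl : m = 0 := Part.mem_some_iff.1 hm
    rfl
  | succ =>
    refine ⟨⟨fun x y => y = succ x, inferInstance⟩, fun n m hm y => ?_⟩
    obtain rfl : m = n + 1 := by simpa using hm
    rfl
  | left =>
    refine ⟨⟨fun x y => ∃ b, Unpair x (pr y b), inferInstance⟩, fun n m hm y => ?_⟩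
    obtain rfl : m = n.unpair.1 := by simpa using hm
    simp [unpair_num_iff]
  | right =>
    refine ⟨⟨fun x y => ∃ a, Unpair x (pr a y), inferInstance⟩, fun n m hm y => ?_⟩
    obtain rfl : m = n.unpair.2 := by simpa using hm
    simp [unpair_num_iff]
  | pair _ _ ihf ihg =>
    obtain ⟨F, hF⟩ := ihf
    obtain ⟨G, hG⟩ := ihg
    refine ⟨⟨fun x y => ∃ a b, F.rel x a ∧ G.rel x b ∧ PairCode ω a b y, inferInstance⟩,
      fun n m hm y => ?_⟩
    simp only [Seq.seq, Part.map_eq_map, Part.mem_bind_iff, Part.mem_map_iff,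
      exists_exists_and_eq_and] at hm
    obtain ⟨a, ha, b, hb, rfl⟩ := hm
    simp [hF n a ha, hG n b hb, hω.pairCode_iff]
  | comp _ _ ihf ihg =>
    obtain ⟨F, hF⟩ := ihf
    obtain ⟨G, hG⟩ := ihg
    refine ⟨⟨fun x y => ∃ a, G.rel x a ∧ F.rel a y, inferInstance⟩, fun n m hm y => ?_⟩
    obtain ⟨a, ha, hm⟩ := Part.mem_bind_iff.1 hm
    simp [hG n a ha, hF a m hm]
  | @prec f g _ _ ihf ihg =>
    obtain ⟨F, hF⟩ := ihf
    obtain ⟨G, hG⟩ := ihg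
    let S : DRel₄ N := ⟨fun a k i y => ∃ t z, PairCode ω k i t ∧ PairCode ω a t z ∧ G.rel z y,
      inferInstance⟩
    refine ⟨⟨fun x y => ∃ a n x₀, Unpair x (pr a n) ∧ F.rel a x₀ ∧ Iter S a x₀ n y,
      inferInstance⟩, fun n m hm y => ?_⟩
    obtain ⟨a, n, rfl⟩ : ∃ a b, n = Nat.pair a b := ⟨_, _, n.pair_unpair.symm⟩
    simp only [Nat.unpaired, Nat.unpair_pair] at hm
    -- The finite history of the recursion; since `m` is a value, all earlier stages are defined.
    have hval : ∃ s : ℕ → ℕ, s 0 ∈ f a ∧ s n = m ∧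
        ∀ k < n, s (k + 1) ∈ g (Nat.pair a (Nat.pair k (s k))) := by
      induction n generalizing m with
      | zero => exact ⟨fun _ => m, hm, rfl, fun k hk => by omega⟩
      | succ n ih =>
        obtain ⟨i, hi, hm⟩ := Part.mem_bind_iff.1 hm
        obtain ⟨s, h0, hn, hs⟩ := ih i hi
        refine ⟨fun k => if k ≤ n then s k else m, by simpa using h0, by simp, fun k hk => ?_⟩
        rcases Nat.lt_succ_iff_lt_or_eq.1 hk with h | rfl
        · simpa [h.le, Nat.succ_le_of_lt h] using hs k h
        · simpa [hn] using hm
    obtain ⟨s, h0, rfl, hs⟩ := hval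
    have hiter := iter_num_iff (S := S) (a := num a) (s := fun k => num (s k)) (n := n)
      (fun k hk y => by simp [S, hω.pairCode_iff, hG _ _ (hs k hk)]) y
    rw [← hiter]
    simp only [unpair_num_iff, Nat.unpair_pair, pr_inj]
    constructor
    · rintro ⟨_, _, x₀, ⟨rfl, rfl⟩, hx, h⟩
      exact (hF a _ h0 x₀).1 hx ▸ h
    · exact fun h => ⟨_, _, _, ⟨rfl, rfl⟩, (hF a _ h0 _).2 rfl, h⟩
  | @rfind f _ ih =>
    obtain ⟨F, hF⟩ := ih
    let Z : DRel₂ N := ⟨fun x k => ∃ z, PairCode ω x k z ∧ F.rel z emp, inferInstance⟩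
    refine ⟨⟨fun x y => Mem y ω ∧ Z.rel x y ∧ ∀ k, Mem k y → ¬ Z.rel x k, inferInstance⟩,
      fun n m hm y => ?_⟩
    obtain ⟨h0, hlt⟩ := Nat.mem_rfind.1 hm
    refine hω.least_iff (P := fun y => Z.rel (num n) y) ?_ (fun k hk => ?_) y
    · have : 0 ∈ f (Nat.pair n m) := by simpa using h0
      simp [Z, hω.pairCode_iff, hF _ _ this, emp_eq]
    · obtain ⟨j, hj, hne⟩ : ∃ j ∈ f (Nat.pair n k), j ≠ 0 := by simpa using hlt hk
      simpa [Z, hω.pairCode_iff, hF _ _ hj, emp_eq] using hne.symm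

theorem IsOmega.exists_dRel (hω : IsOmega Mem ω) {f : ℕ → ℕ} (hf : Computable f) :
    ∃ R : DRel₂ N, ∀ n y, R.rel (num n) y ↔ y = num (f n) := by
  obtain ⟨R, hR⟩ := hω.representable (Partrec.nat_iff.1 hf)
  exact ⟨R, fun n => hR n (f n) (by simp)⟩

end Representation
/-! ### Satisfaction in a set structure -/

section Satisfaction

open FirstOrder.Language

variable {N : Type u} [LSet.Structure N] [N ⊨ ZFC]

/-- Assignments are total on `ω`, so no bookkeeping of the variables of a formula is needed. -/
theorem exists_asg (ω m : N) : ∃ A : N, ∀ v, Mem v A ↔ Mem v (pow (prod ω m)) ∧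
    ∀ i, Mem i ω → ∃ x, ∀ y, Mem (pr i y) v ↔ y = x :=
  exists_sep (fun v => ∀ i, Mem i ω → ∃ x, ∀ y, Mem (pr i y) v ↔ y = x) _

/-- The set of all functions from `ω` to `m` in `N`. -/
noncomputable def asg (ω m : N) : N := (exists_asg ω m).choose

theorem mem_asg {ω m v : N} : Mem v (asg ω m) ↔ (∀ q, Mem q v → Mem q (prod ω m)) ∧
    ∀ i, Mem i ω → ∃ x, ∀ y, Mem (pr i y) v ↔ y = x := by
  rw [asg, (exists_asg ω m).choose_spec, mem_pow]

/-- `v'` is the function `v` with its value at `i` replaced by `x`. -/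
def IsUpdate (i x v v' : N) : Prop :=
  ∀ j y, Mem (pr j y) v' ↔ (j = i ∧ y = x) ∨ (j ≠ i ∧ Mem (pr j y) v)

instance {γ : Type u} [Ctx N γ] {i x v v' : γ → N} [hi : DFun N i] [hx : DFun N x]
    [hv : DFun N v] [hv' : DFun N v'] : Dfn N (fun c => IsUpdate (i c) (x c) (v c) (v' c)) := by
  have := hi.weaken.weaken
  have := hx.weaken.weaken
  have := hv.weaken.weaken
  have := hv'.weaken.weaken
  unfold IsUpdate; infer_instance

theorem exists_update {ω m v i x : N} (hv : Mem v (asg ω m)) (hi : Mem i ω) (hx : Mem x m) :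
    ∃ v', Mem v' (asg ω m) ∧ IsUpdate i x v v' := by
  obtain ⟨hsub, hfun⟩ := mem_asg.1 hv
  obtain ⟨v', hv'⟩ := exists_sep
    (fun q => ∃ j y, q = pr j y ∧ ((j = i ∧ y = x) ∨ (j ≠ i ∧ Mem (pr j y) v))) (prod ω m)
  have hupd : IsUpdate i x v v' := by
    intro j y
    rw [hv']
    constructor
    · rintro ⟨-, j', y', h, h'⟩
      obtain ⟨rfl, rfl⟩ := pr_inj.1 h
      exact h'
    · intro h
      refine ⟨?_, j, y, rfl, h⟩
      rcases h with ⟨rfl, rfl⟩ | ⟨-, h⟩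
      · exact pr_mem_prod.2 ⟨hi, hx⟩
      · exact hsub _ h
  refine ⟨v', mem_asg.2 ⟨fun q hq => ((hv' q).1 hq).1, fun j hj => ?_⟩, hupd⟩
  by_cases hji : j = i
  · exact ⟨x, fun y => (hupd j y).trans (by simp [hji])⟩
  · obtain ⟨z, hz⟩ := hfun j hj
    exact ⟨z, fun y => by simp [hupd j y, hji, hz]⟩

theorem rel_iff_mem {m e : N} {M : Type v} [LSet.Structure M]
    (F : (Mem : M → M → Prop) ≃r extRel m e) {a b : M} : Mem (pr (F a).1 (F b).1) e ↔ Mem a b := by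
  rw [← F.map_rel_iff]
  simp [extRel, isPair_iff]

variable [Nonempty N]

variable (N) in
/-- Definable relations by which `N` decodes Gödel codes. -/
structure Decoder where
  /-- The kind of the formula with a given code. -/
  kind : DRel₂ N
  /-- The left constituent of an atomic formula or an implication. -/
  left : DRel₂ N
  /-- The right constituent of an atomic formula or an implication. -/
  right : DRel₂ N
  /-- The formula under a quantifier. -/
  body : DRel₂ N
  /-- The code of the variable bound by a quantifier of a given depth. -/
  bvar : DRel₂ N
  -- `godelCode` gives `falsum` the code `0`; for the other constructors the residue of `c - 1` mod
  -- `4` is the kind and the quotient holds the constituents. In `α ⊕ Fin n`, free variables have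
  -- even codes and the bound variable `i` has code `2 * i + 1`.
  kind_iff : ∀ c y, kind.rel (num c) y ↔ y = num (if c = 0 then 0 else (c - 1) % 4 + 1)
  left_iff : ∀ c y, left.rel (num c) y ↔ y = num ((c - 1) / 4).unpair.1
  right_iff : ∀ c y, right.rel (num c) y ↔ y = num ((c - 1) / 4).unpair.2
  body_iff : ∀ c y, body.rel (num c) y ↔ y = num ((c - 1) / 4)
  bvar_iff : ∀ n y, bvar.rel (num n) y ↔ y = num (2 * n + 1)

theorem IsOmega.nonempty_decoder {ω : N} (hω : IsOmega Mem ω) : Nonempty (Decoder N) := by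
  have hbody : Primrec fun c : ℕ => (c - 1) / 4 :=
    Primrec.nat_div.comp (Primrec.nat_sub.comp Primrec.id (Primrec.const 1)) (Primrec.const 4)
  have hkind : Primrec fun c : ℕ => if c = 0 then 0 else (c - 1) % 4 + 1 :=
    Primrec.ite (Primrec.eq.comp Primrec.id (Primrec.const 0)) (Primrec.const 0)
      (Primrec.succ.comp (Primrec.nat_mod.comp
        (Primrec.nat_sub.comp Primrec.id (Primrec.const 1)) (Primrec.const 4)))
  have hbvar : Primrec fun n : ℕ => 2 * n + 1 :=
    Primrec.succ.comp (Primrec.nat_mul.comp (Primrec.const 2) Primrec.id)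
  obtain ⟨K, hK⟩ := hω.exists_dRel hkind.to_comp
  obtain ⟨L, hL⟩ := hω.exists_dRel (Primrec.fst.comp (Primrec.unpair.comp hbody)).to_comp
  obtain ⟨R, hR⟩ := hω.exists_dRel (Primrec.snd.comp (Primrec.unpair.comp hbody)).to_comp
  obtain ⟨B, hB⟩ := hω.exists_dRel hbody.to_comp
  obtain ⟨V, hV⟩ := hω.exists_dRel hbvar.to_comp
  exact ⟨⟨K, L, R, B, V, hK, hL, hR, hB, hV⟩⟩

variable (ω m e : N) (D : Decoder N)

set_option synthInstance.maxSize 2000 in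
set_option synthInstance.maxHeartbeats 400000 in
/-- Tarski's clause for the formula with code `c` at depth `n` and the assignment `v`, where `T` is
the satisfaction relation for smaller codes. -/
def tarskiClause : DRel₄ N where
  -- The elements of `T` are triples `(c, (n, v))`. The depth `n` is carried along because the code
  -- of a quantified formula does not record which variable it binds.
  rel c T n v :=
    (D.kind.rel c (num 1) ∧ ∃ i j x, D.left.rel c i ∧ D.right.rel c j ∧
      Mem (pr i x) v ∧ Mem (pr j x) v) ∨
    (D.kind.rel c (num 2) ∧ ∃ i j x y, D.left.rel c i ∧ D.right.rel c j ∧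
      Mem (pr i x) v ∧ Mem (pr j y) v ∧ Mem (pr x y) e) ∨
    (D.kind.rel c (num 3) ∧ ∃ a b, D.left.rel c a ∧ D.right.rel c b ∧
      (Mem (pr a (pr n v)) T → Mem (pr b (pr n v)) T)) ∨
    (D.kind.rel c (num 4) ∧ ∃ a i, D.body.rel c a ∧ D.bvar.rel n i ∧
      ∀ x v', Mem x m → Mem v' (asg ω m) → IsUpdate i x v v' → Mem (pr a (pr (succ n) v')) T)
  dfn := by infer_instance

/-- `T'` extends the satisfaction relation `T` by the formula with code `c`. -/
def satStep : DRel₄ N where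
  rel _ c T T' := ∀ t, Mem t T' ↔ Mem t T ∨ ∃ n v, Mem n ω ∧ Mem v (asg ω m) ∧
    t = pr c (pr n v) ∧ (tarskiClause ω m e D).rel c T n v
  dfn := by infer_instance

theorem exists_satStep (a c T : N) : ∃ T', (satStep ω m e D).rel a c T T' := by
  obtain ⟨T', hT'⟩ := exists_sep (fun t => Mem t T ∨ ∃ n v, Mem n ω ∧ Mem v (asg ω m) ∧
    t = pr c (pr n v) ∧ (tarskiClause ω m e D).rel c T n v)
    (cup T (prod (upair c c) (prod ω (asg ω m))))
  refine ⟨T', fun t => (hT' t).trans (and_iff_right_of_imp ?_)⟩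
  rintro (h | ⟨n, v, hn, hv, rfl, -⟩)
  · exact mem_cup.2 (.inl h)
  · exact mem_cup.2 (.inr (by simp [hn, hv]))

/-- The satisfaction relations for the formulas with codes below a standard number. -/
noncomputable def satSeq : ℕ → N
  | 0 => emp
  | c + 1 => (exists_satStep ω m e D emp (num c) (satSeq c)).choose

theorem mem_satSeq_succ {c : ℕ} {t : N} : Mem t (satSeq ω m e D (c + 1)) ↔
    Mem t (satSeq ω m e D c) ∨ ∃ n v, Mem n ω ∧ Mem v (asg ω m) ∧ t = pr (num c) (pr n v) ∧
      (tarskiClause ω m e D).rel (num c) (satSeq ω m e D c) n v :=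
  (exists_satStep ω m e D emp (num c) (satSeq ω m e D c)).choose_spec t

variable {ω m e D}

theorem satStep_iff {c : ℕ} {y : N} :
    (satStep ω m e D).rel emp (num c) (satSeq ω m e D c) y ↔ y = satSeq ω m e D (c + 1) :=
  ⟨fun h => Mem.ext fun t => (h t).trans (mem_satSeq_succ ω m e D).symm,
    fun h _ => h ▸ mem_satSeq_succ ω m e D⟩

/-- Triples with code `c` enter only at stage `c + 1`, so Tarski's clause over stage `c` decides
them at every later stage. -/
theorem mem_satSeq {c d : ℕ} {n v : N} : Mem (pr (num c) (pr n v)) (satSeq ω m e D d) ↔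
    c < d ∧ Mem n ω ∧ Mem v (asg ω m) ∧
      (tarskiClause ω m e D).rel (num c) (satSeq ω m e D c) n v := by
  induction d with
  | zero => simp [satSeq]
  | succ d ih =>
    rw [mem_satSeq_succ, ih]
    simp only [pr_inj, num_inj]
    constructor
    · rintro (⟨h, h'⟩ | ⟨n', v', hn, hv, ⟨rfl, rfl, rfl⟩, h⟩)
      · exact ⟨by omega, h'⟩
      · exact ⟨by omega, hn, hv, h⟩
    · rintro ⟨h, h'⟩
      rcases Nat.lt_succ_iff_lt_or_eq.1 h with h | rfl
      · exact .inl ⟨h, h'⟩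
      · exact .inr ⟨n, v, h'.1, h'.2.1, ⟨rfl, rfl, rfl⟩, h'.2.2⟩

/-! ### Correctness of the internal satisfaction relation for standard formulas -/

variable {M : Type v} [LSet.Structure M] (F : (Mem : M → M → Prop) ≃r extRel m e)

/-- The assignment `v` in `N` has the values `g` at the numerals. -/
def Agrees (v : N) (g : ℕ → M) : Prop := ∀ i y, Mem (pr (num i) y) v ↔ y = (F (g i)).1

theorem exists_agrees (hω : IsOmega Mem ω) {v : N} (hv : Mem v (asg ω m)) :
    ∃ g, Agrees F v g := by
  obtain ⟨hsub, hfun⟩ := mem_asg.1 hv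
  choose x hx using fun i : ℕ => hfun (num i) (hω.num_mem i)
  have hxm : ∀ i, Mem (x i) m := fun i => (pr_mem_prod.1 (hsub _ ((hx i _).2 rfl))).2
  exact ⟨fun i => F.symm ⟨x i, hxm i⟩, fun i y => by simp [hx]⟩

theorem Agrees.update {v v' : N} {g : ℕ → M} (h : Agrees F v g) {i : ℕ} {b : M}
    (hu : IsUpdate (num i) (F b).1 v v') : Agrees F v' (Function.update g i b) := by
  intro j y
  rw [hu]
  by_cases hji : j = i
  · subst hji; simp
  · simp [hji, h j y]

/-- An external `g` need not come from an element of `N`, but finitely many values can be prescribed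
by updating a constant assignment. -/
theorem exists_asg_agrees [Nonempty M] (hω : IsOmega Mem ω) (g : ℕ → M) (B : ℕ) :
    ∃ v, Mem v (asg ω m) ∧ ∃ g', Agrees F v g' ∧ ∀ i < B, g' i = g i := by
  induction B with
  | zero =>
    let b : M := Classical.arbitrary M
    refine ⟨prod ω (upair (F b).1 (F b).1), mem_asg.2 ⟨fun q hq => ?_, fun i hi => ?_⟩,
      fun _ => b, fun i y => by simp [hω.num_mem i], by simp⟩
    · obtain ⟨x, y, hx, hy, rfl⟩ := mem_prod.1 hq
      simp only [mem_upair, or_self] at hy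
      subst hy
      exact pr_mem_prod.2 ⟨hx, (F b).2⟩
    · exact ⟨(F b).1, fun y => by simp [hi]⟩
  | succ B ih =>
    obtain ⟨v, hv, g', hg', h⟩ := ih
    obtain ⟨v', hv', hu⟩ := exists_update hv (hω.num_mem B) (F (g B)).2
    refine ⟨v', hv', _, hg'.update F hu, fun i hi => ?_⟩
    by_cases hiB : i = B
    · subst hiB; simp
    · simp [hiB, h i (by omega)]

theorem termCode_realize {α : Type w} [Encodable α] {n : ℕ} (g : ℕ → M)
    (t : LSet.Term (α ⊕ Fin n)) :
    t.realize (Sum.elim (fun a => g (2 * Encodable.encode a)) fun i : Fin n => g (2 * i + 1)) =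
      g (termCode t) := by
  rcases t with (a | i) | ⟨f, _⟩
  · simp [termCode]
  · simp only [Term.realize_var, Sum.elim_inr, termCode, Encodable.encode_inr]
    rfl
  · exact nomatch f

/-- The internal satisfaction relation is correct for the codes of formulas. -/
theorem mem_satSeq_godelCode (hω : IsOmega Mem ω) {α : Type w} [Encodable α] {n : ℕ}
    (φ : LSet.BoundedFormula α n) {d : ℕ} (hd : godelCode φ < d) {v : N} (hv : Mem v (asg ω m))
    {g : ℕ → M} (hg : Agrees F v g) :
    Mem (pr (num (godelCode φ)) (pr (num n) v)) (satSeq ω m e D d) ↔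
      φ.Realize (fun a => g (2 * Encodable.encode a)) (fun i => g (2 * i + 1)) := by
  induction φ generalizing d v g with
  | falsum =>
    simp [mem_satSeq, tarskiClause, godelCode, D.kind_iff, BoundedFormula.Realize]
  | @equal n t s =>
    rw [BoundedFormula.Realize, termCode_realize, termCode_realize]
    have hdiv : (4 * Nat.pair (termCode t) (termCode s) + 1 - 1) / 4 =
      Nat.pair (termCode t) (termCode s) := by omega
    have hmod : (4 * Nat.pair (termCode t) (termCode s) + 1 - 1) % 4 = 0 := by omega
    simp only [godelCode] at hd
    simp only [mem_satSeq, tarskiClause, godelCode, D.kind_iff, D.left_iff, D.right_iff, hdiv,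
      hmod, hd, hω.num_mem, hv, num_inj, Nat.unpair_pair]
    simp [hg _ _, Subtype.val_inj]
  | @rel n l R ts =>
    cases R
    have : BoundedFormula.Realize (BoundedFormula.rel memSymb ts)
        (fun a => g (2 * Encodable.encode a)) (fun i : Fin n => g (2 * i + 1)) ↔
        Mem (g (termCode (ts 0))) (g (termCode (ts 1))) := by
      refine (BoundedFormula.realize_rel (R := memSymb) (ts := ts)).trans ?_
      rw [Mem]
      refine iff_of_eq (congrArg _ (funext fun i => ?_))
      rw [termCode_realize]
      fin_cases i <;> rfl
    refine Iff.trans ?_ this.symm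
    have hdiv : (4 * Nat.pair (termCode (ts 0)) (termCode (ts 1)) + 2 - 1) / 4 =
      Nat.pair (termCode (ts 0)) (termCode (ts 1)) := by omega
    have hmod : (4 * Nat.pair (termCode (ts 0)) (termCode (ts 1)) + 2 - 1) % 4 = 1 := by omega
    simp only [godelCode] at hd
    simp only [mem_satSeq, tarskiClause, godelCode, D.kind_iff, D.left_iff, D.right_iff, hdiv,
      hmod, hd, hω.num_mem, hv, num_inj, Nat.unpair_pair]
    simp [hg _ _, rel_iff_mem F]
  | @imp n φ ψ ihφ ihψ =>
    have hdiv : (4 * Nat.pair (godelCode φ) (godelCode ψ) + 3 - 1) / 4 =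
      Nat.pair (godelCode φ) (godelCode ψ) := by omega
    have hmod : (4 * Nat.pair (godelCode φ) (godelCode ψ) + 3 - 1) % 4 = 2 := by omega
    have hl := Nat.left_le_pair (godelCode φ) (godelCode ψ)
    have hr := Nat.right_le_pair (godelCode φ) (godelCode ψ)
    simp only [godelCode] at hd
    rw [BoundedFormula.realize_imp, godelCode, mem_satSeq,
      -- The clause for an implication consults the stage indexed by its own code, which exceeds
      -- both subcodes.
      ← ihφ (d := 4 * Nat.pair (godelCode φ) (godelCode ψ) + 3) (by omega) hv hg,
      ← ihψ (d := 4 * Nat.pair (godelCode φ) (godelCode ψ) + 3) (by omega) hv hg]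
    simp only [tarskiClause, D.kind_iff, D.left_iff, D.right_iff, hdiv,
      hmod, hd, hω.num_mem, hv, num_inj, Nat.unpair_pair]
    simp
  | @all n φ ih =>
    have hdiv : (4 * godelCode φ + 4 - 1) / 4 = godelCode φ := by omega
    have hmod : (4 * godelCode φ + 4 - 1) % 4 = 3 := by omega
    simp only [godelCode] at hd
    rw [BoundedFormula.realize_all, godelCode, mem_satSeq]
    simp only [tarskiClause, D.kind_iff, D.body_iff, D.bvar_iff, hdiv,
      hmod, hd, hω.num_mem, hv, num_inj, succ_num]
    simp only [Nat.add_eq_zero_iff, OfNat.ofNat_ne_zero, and_false, if_false, Nat.reduceAdd,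
      Nat.reduceEqDiff, false_and, false_or, true_and]
    -- Updating slot `2 * n + 1` appends `b` to the bound variables and leaves the free variables
    -- and earlier bound ones alone.
    have hstep : ∀ (b : M) (v' : N), Mem v' (asg ω m) → IsUpdate (num (2 * n + 1)) (F b).1 v v' →
        (Mem (pr (num (godelCode φ)) (pr (num (n + 1)) v'))
          (satSeq ω m e D (4 * godelCode φ + 4)) ↔
        φ.Realize (fun a => g (2 * Encodable.encode a))
          (Fin.snoc (fun i : Fin n => g (2 * i + 1)) b)) := by
      intro b v' hv' hu
      rw [ih (by omega) hv' (hg.update F hu)]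
      refine iff_of_eq (congrArg₂ _ (funext fun a => ?_) (funext fun i => ?_))
      · exact Function.update_of_ne (by omega) _ _
      · refine Fin.lastCases ?_ (fun i => ?_) i
        · simp
        · have := i.2
          rw [Fin.snoc_castSucc]
          exact Function.update_of_ne (by simp; omega) _ _
    constructor
    · rintro ⟨_, _, rfl, rfl, h⟩ b
      obtain ⟨v', hv', hu⟩ := exists_update hv (hω.num_mem (2 * n + 1)) (F b).2
      exact (hstep b v' hv' hu).1 (h _ v' (F b).2 hv' hu)
    · refine fun h => ⟨_, _, rfl, rfl, fun x v' hx hv' hu => ?_⟩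
      obtain ⟨b, hb⟩ := F.surjective ⟨x, hx⟩
      obtain rfl : (F b).1 = x := by rw [hb]
      exact (hstep b v' hv' hu).2 (h b)

variable (ω m e D) in
/-- In `N`, the assignment `v` satisfies the formula with code `c` in `⟨m, e⟩`. -/
def Sat (c v : N) : Prop :=
  ∃ T, Iter (satStep ω m e D) emp emp (succ c) T ∧ Mem (pr c (pr emp v)) T

instance {γ : Type u} [Ctx N γ] {c v : γ → N} [hc : DFun N c] [hv : DFun N v] :
    Dfn N (fun p => Sat ω m e D (c p) (v p)) := by
  have := hc.weaken
  have := hv.weaken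
  unfold Sat; infer_instance

/-- At a standard code the iteration in `Sat` yields exactly `satSeq` at `c + 1`, the first stage
that treats `c`; a formula has depth `0`, hence the `emp` in `Sat`. -/
theorem sat_godelCode (hω : IsOmega Mem ω) {α : Type w} [Encodable α] (φ : LSet.Formula α)
    {v : N} (hv : Mem v (asg ω m)) {g : ℕ → M} (hg : Agrees F v g) :
    Sat ω m e D (num (godelCode φ)) v ↔ φ.Realize fun a => g (2 * Encodable.encode a) := by
  have hiter := iter_num_iff (S := satStep ω m e D) (a := emp) (s := satSeq ω m e D)
    (n := godelCode φ + 1) (fun _ _ _ => satStep_iff)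
  simp only [Sat, succ_num]
  have h := mem_satSeq_godelCode (D := D) F hω φ (Nat.lt_succ_self _) hv hg
  rw [Formula.Realize, Subsingleton.elim (default : Fin 0 → M) _, ← h]
  constructor
  · rintro ⟨T, hT, hmem⟩
    exact (hiter T).1 hT ▸ hmem
  · exact fun h => ⟨_, (hiter _).2 rfl, h⟩

end Satisfaction
/-! ### Computable saturation -/

section Saturation

open FirstOrder.Language

theorem IsOmega.computablySaturated {N : Type u} [LSet.Structure N] [N ⊨ ZFC] [Nonempty N]
    {ω : N} (hω : IsOmega Mem ω) (hns : ∃ x : N, Mem x ω ∧ ∀ n, x ≠ num n) {m e : N}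
    {M : Type v} [LSet.Structure M] [Nonempty M] (F : (Mem : M → M → Prop) ≃r extRel m e) :
    ComputablySaturated M := by
  classical
  intro k n a p hp hfin
  obtain ⟨D⟩ := hω.nonempty_decoder
  obtain ⟨χ, hχ⟩ : ∃ R : DRel₂ N, ∀ c, R.rel (num c) (num 1) ↔ c ∈ godelCode '' p := by
    obtain ⟨f, hf, hfp⟩ := ComputablePred.computable_iff.1 hp
    obtain ⟨R, hR⟩ := hω.exists_dRel (f := fun c => bif f c then 1 else 0)
      (Computable.cond hf (Computable.const 1) (Computable.const 0))
    refine ⟨R, fun c => ?_⟩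
    rw [hR, num_inj, congrFun hfp c]
    cases f c <;> simp
  let P : N → Prop := fun d => ∃ v, Mem v (asg ω m) ∧
    (∀ i : Fin k, Mem (pr (num (2 * Encodable.encode (Sum.inl i : Fin k ⊕ Fin n))) (F (a i)).1) v) ∧
    ∀ c, Mem c d → χ.rel c (num 1) → Sat ω m e D c v
  have hP : ∀ d, P (num d) := by
    intro d
    -- Codes are injective, so a standard bound leaves a finite part of `p`, and finite
    -- realizability applies.
    have hs : {φ | φ ∈ p ∧ godelCode φ < d}.Finite :=
      ((Set.finite_lt_nat d).preimage godelCode_injective.injOn).subset fun φ h => h.2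
    obtain ⟨x, hx⟩ := hfin hs.toFinset (fun φ h => (hs.mem_toFinset.1 h).1)
    let z₀ : M := Classical.arbitrary M
    obtain ⟨B, hB⟩ := (Set.finite_range fun z : Fin k ⊕ Fin n => 2 * Encodable.encode z).bddAbove
    -- Slot `2 * encode z` receives the value of the variable `z`; `z₀` fills slots that decode to
    -- no variable, and `B` bounds the slots that matter.
    obtain ⟨v, hv, g, hg, hgB⟩ := exists_asg_agrees F hω (fun c =>
      ((Encodable.decode (α := Fin k ⊕ Fin n) (c / 2)).map (Sum.elim a x)).getD z₀) (B + 1)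
    have hgz : (fun z => g (2 * Encodable.encode z)) = Sum.elim a x := by
      funext z
      rw [hgB _ (Nat.lt_succ_of_le (hB ⟨z, rfl⟩))]
      simp
    refine ⟨v, hv, fun i => (hg _ _).2 ?_, fun c hc hcp => ?_⟩
    · exact congrArg (fun b => (F b).1) (congrFun hgz (Sum.inl i)).symm
    · obtain ⟨c, hcd, rfl⟩ := mem_num.1 hc
      obtain ⟨φ, hφ, rfl⟩ := (hχ c).1 hcp
      rw [sat_godelCode F hω φ hv hg, hgz]
      exact hx φ (hs.mem_toFinset.2 ⟨hφ, hcd⟩)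
  -- All standard codes lie below this `d`, so the single assignment `v` satisfies the whole of `p`.
  obtain ⟨d, -, ⟨v, hv, hva, hsat⟩, hd⟩ := hω.overspill hns P hP
  obtain ⟨g, hg⟩ := exists_agrees F hω hv
  refine ⟨fun j => g (2 * Encodable.encode (Sum.inr j : Fin k ⊕ Fin n)), fun φ hφ => ?_⟩
  have h := (sat_godelCode F hω φ hv hg).1 (hsat _ (hd _) ((hχ _).2 ⟨φ, hφ, rfl⟩))
  convert h using 1
  funext z
  rcases z with i | j
  · exact F.injective (Subtype.ext ((hg _ _).1 (hva i)))
  · rfl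

/-- A model that `N'` thinks to have an ill-founded `ω` is `ω`-nonstandard. -/
theorem ThinksOmegaIllFounded.omegaNonstandard {N' : Type u} [LSet.Structure N']
    {N : Type v} [LSet.Structure N] [N ⊨ ZFC] [Nonempty N] {m e : N'}
    (F : (Mem : N → N → Prop) ≃r extRel m e) (h : ThinksOmegaIllFounded m e) :
    OmegaNonstandard N := by
  obtain ⟨w, hw, s, ⟨x₀, hx₀⟩, hsw, hmin⟩ := h
  have hF : ∀ a b : N, extRel m e (F a) (F b) ↔ Mem a b := fun a b => F.map_rel_iff
  have hex : ∀ Q : {a : N' // Mem a m} → Prop, (∀ y, Q y) ↔ ∀ b, Q (F b) := fun Q =>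
    F.surjective.forall
  have hex' : ∀ Q : {a : N' // Mem a m} → Prop, (∃ y, Q y) ↔ ∃ b, Q (F b) := fun Q =>
    F.surjective.exists
  -- Being `ω` is expressed by quantifiers over the structure, so it transfers along the
  -- isomorphism.
  have hω : IsOmega Mem (F.symm w) := by
    obtain ⟨w, rfl⟩ := F.surjective w
    simp only [IsOmega, IsInductive, IsEmptySet, IsSuccOf, hex, hex', hF, F.injective.eq_iff] at hw
    simpa [IsOmega, IsInductive, IsEmptySet, IsSuccOf] using hw
  refine ⟨F.symm w, hω, ?_⟩
  by_contra! hstd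
  have hnum : ∀ x, Mem x s → ∃ n : ℕ, ((F (num n)).1 : N') = x := by
    intro x hx
    obtain ⟨hxm, hxw⟩ := hsw x hx
    obtain ⟨b, hb⟩ := F.surjective ⟨x, hxm⟩
    obtain ⟨n, hn⟩ := hstd b (by rw [← hF, hb, F.apply_symm_apply]; exact hxw)
    exact ⟨n, by rw [← isNumeral_iff.1 hn, hb]⟩
  -- If `ω` were standard, `s` would consist of numerals, and passing to `e`-smaller members of `s`
  -- would descend forever in `ℕ`.
  have key : ∀ n : ℕ, ¬ Mem (F (num n)).1 s := by
    intro n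
    induction n using Nat.strong_induction_on with
    | _ n ih =>
      intro hn
      obtain ⟨y, hy, q, hq, hpair⟩ := hmin _ hn
      obtain ⟨k, rfl⟩ := hnum y hy
      exact ih k (num_mem_num.1 ((hF (num k : N) (num n)).1 ⟨q, hq, hpair⟩)) hy
  obtain ⟨n, rfl⟩ := hnum x₀ hx₀
  exact key n hx₀

theorem ComputablySaturated.of_isElementOf {M : Type u} [LSet.Structure M] [Nonempty M]
    {N : Type v} [LSet.Structure N] [N ⊨ ZFC] [Nonempty N] (hN : OmegaNonstandard N)
    (h : IsElementOf M N) : ComputablySaturated M := by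
  obtain ⟨ω, hω, x, hx, hxn⟩ := hN
  obtain ⟨p, m, e, -, -, ⟨F⟩⟩ := h
  exact hω.computablySaturated ⟨x, hx, fun n hn => hxn n (isNumeral_iff.2 hn)⟩ F

end Saturation
end SetModels

open SetModels
theorem mainTheorem4 :
    (∀ (M : ZFC.ModelType.{0, 0, u}) (N : ZFC.ModelType.{0, 0, v}),
      OmegaNonstandard N → IsElementOf M N → ComputablySaturated M) ∧
    (∀ 𝓜 : Multiverse.{w}, 𝓜.WellfoundednessMirage →
      ∀ M ∈ 𝓜.models, ComputablySaturated M) := by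
  refine ⟨fun M N hN h => .of_isElementOf hN h, fun 𝓜 h𝓜 M hM => ?_⟩
  obtain ⟨N, hN, p, m, e, hMN, -⟩ := h𝓜 M hM
  obtain ⟨N', -, p', m', e', ⟨-, -, ⟨F⟩⟩, hill⟩ := h𝓜 N hN
  exact .of_isElementOf (hill.omegaNonstandard F) ⟨p, m, e, hMN⟩
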